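/- Let $1 \le k \le n$, let $X$ be an $n \times n$ matrix over a commutative ring, and let $T$ be the $n \times n$ matrix with entries $T_{ij} = 1 + \operatorname{sgn}(i-j)$, that is, $T_{ij} = 0$ for $i<j$, $T_{ij}=1$ for $i=j$, and $T_{ij}=2$ for $i>j$. For $k$-element subsets $I = \{i_1 < \dots < i_k\}$ and $J = \{j_1 < \dots < j_k\}$ of $[n]=\{1,\dots,n\}$, let $\det A_{IJ}$ denote the minor $\det\big(a_{i_r j_s}\big)_{r,s=1}^k$ of an $n \times n$ matrix $A = (a_{ij})$, let $p(I,J) = k - |I \cap J|$, and write $I \le J$ if $I$ and $J$ are interlacing, i.e. $i_1 \le j_1 \le i_2 \le j_2 \le \dots \le i_k \le j_k$. Put $$S = \sum_{\substack{I, J \subseteq [n],\ |I|=|J|=k \\ I \le J}} 2^{p(I,J)} \det X_{IJ}.$$ Then: (a) The sum of the principal $k \times k$ minors of $TX$ equals $S$: $\displaystyle\sum_{|J|=k} \det (TX)_{JJ} = S$. (b) If $X$ is symmetric, then the sum of all $k \times k$ minors of $X$ (principal and non-principal) equals $S$: $\displaystyle\sum_{|I|=|J|=k} \det X_{IJ}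 = S$. -/

import Mathlib

namespace CanadaDay

/-- The matrix `T` with entries `1 + sgn (i - j)`. -/
def T (n : ℕ) (R : Type*) [CommRing R] : Matrix (Fin n) (Fin n) R :=
  Matrix.of fun i j => if i < j then 0 else if i = j then 1 else 2

/-- The increasing enumeration `i₁ < ⋯ < iₖ` of a `k`-element subset `I` of `[n]`. -/
def enum {n k : ℕ} (I : Set.powersetCard (Fin n) k) : Fin k ↪o Fin n :=
  I.1.orderEmbOfFin I.2

/-- The minor of `X` with row set `I` and column set `J`. -/
def minor {n k : ℕ} {R : Type*} [CommRing R] (X : Matrix (Fin n) (Fin n) R)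
    (I J : Set.powersetCard (Fin n) k) : R :=
  (X.submatrix (enum I) (enum J)).det

/-- `I ≤ J` in the interlacing sense: `i₁ ≤ j₁ ≤ i₂ ≤ j₂ ≤ ⋯ ≤ iₖ ≤ jₖ`. -/
def Interlacing {n k : ℕ} (I J : Set.powersetCard (Fin n) k) : Prop :=
  (∀ m : Fin k, enum I m ≤ enum J m) ∧
    ∀ m m' : Fin k, (m : ℕ) + 1 = (m' : ℕ) → enum J m ≤ enum I m'

instance decidableInterlacing {n k : ℕ} (I J : Set.powersetCard (Fin n) k) : Decidable (Interlacing I J) := by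
  unfold Interlacing
  infer_instance

/-- `p(I, J) = k - |I ∩ J|`; the subtraction never truncates, since `|I ∩ J| ≤ |I| = k`. -/
def p {n k : ℕ} (I J : Set.powersetCard (Fin n) k) : ℕ :=
  k - ((I : Finset (Fin n)) ∩ (J : Finset (Fin n))).card

/-- `S`, the sum of `2 ^ p(I, J) * det X_{IJ}` over the interlacing pairs `I ≤ J`
of `k`-element subsets of `[n]`. -/
def S {n : ℕ} (k : ℕ) {R : Type*} [CommRing R] (X : Matrix (Fin n) (Fin n) R) : R :=
  ∑ IJ : Set.powersetCard (Fin n) k × Set.powersetCard (Fin n) k with Interlacing IJ.1 IJ.2,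
    2 ^ p IJ.1 IJ.2 * minor X IJ.1 IJ.2

end CanadaDay

namespace CanadaDay

open Matrix
open Set.powersetCard (ofFinEmbEquiv)

/-! For (a), Cauchy–Binet expands `det (TX)_{JJ}` into products of minors of `T` and `X`, and the
minor of `T` with rows `J` and columns `I` is `2 ^ p(I, J)` if `I ≤ J` and `0` otherwise
(`det_sgnEntry`).

For (b), write `X = V * diagonal c * Vᵀ`. By Cauchy–Binet, both the sum of all minors of `X` and the
sum of principal minors of `TX` are sums over `k`-sets `L` of columns of `V`, weighted by the
product of `c` over `L`. The remaining factors are the square of the sum of maximal minors of these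
columns and their Gram determinant for the form `xᵀ T y`. The two agree by `det_gram`, an analogue
of the squared Pfaffian, proved for generic vectors by induction on `k` with Cramer's rule. -/

theorem alternatingMap_sum_apply {R M N σ : Type*} [CommRing R] [AddCommGroup M] [Module R M]
    [AddCommGroup N] [Module R N] {k : ℕ} (s : Finset σ)
    (F : σ → M [⋀^Fin k]→ₗ[R] N) (v : Fin k → M) :
    (∑ a ∈ s, F a) v = ∑ a ∈ s, F a v :=
  map_sum (⟨⟨fun F => F v, rfl⟩, fun _ _ => rfl⟩ : M [⋀^Fin k]→ₗ[R] N →+ N) F s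

/-! ### Alternating forms and Cauchy–Binet -/

section CauchyBinet

variable {R : Type*} [CommRing R] {ι : Type*} [LinearOrder ι] {k : ℕ}

/-- Alternating maps on `ι → R` are determined by their values on the increasing tuples of
standard basis vectors. -/
theorem alternatingMap_ext_single [Fintype ι] {N : Type*} [AddCommGroup N] [Module R N]
    {f g : (ι → R) [⋀^Fin k]→ₗ[R] N}
    (h : ∀ φ : Fin k ↪o ι, f (fun r => Pi.single (φ r) 1) = g (fun r => Pi.single (φ r) 1)) :
    f = g := by
  apply exteriorPower.alternatingMapLinearEquiv.injective
  apply ((Pi.basisFun R ι).exteriorPower k).ext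
  intro s
  rw [exteriorPower.basis_apply, exteriorPower.ιMulti_family,
    exteriorPower.alternatingMapLinearEquiv_apply_ιMulti,
    exteriorPower.alternatingMapLinearEquiv_apply_ιMulti]
  have := h (ofFinEmbEquiv.symm s)
  convert this using 2 <;> (ext1 r; simp)

/-- The minor with columns in `I`, as an alternating form in the rows. -/
def minorForm (R : Type*) [CommRing R] (I : Set.powersetCard ι k) : (ι → R) [⋀^Fin k]→ₗ[R] R :=
  detRowAlternating.compLinearMap (LinearMap.funLeft R R (ofFinEmbEquiv.symm I))

theorem minorForm_apply (I : Set.powersetCard ι k) (v : Fin k → ι → R) :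
    minorForm R I v = ((of v).submatrix id (ofFinEmbEquiv.symm I)).det := rfl

theorem minorForm_single (I : Set.powersetCard ι k) (φ : Fin k ↪o ι) :
    minorForm R I (fun r => Pi.single (φ r) 1) =
      if I = ofFinEmbEquiv φ then 1 else 0 := by
  rw [minorForm_apply]
  split_ifs with h
  · rw [h, Equiv.symm_apply_apply]
    convert det_one (n := Fin k) (R := R)
    ext a b
    simp [Pi.single_apply, Matrix.one_apply, eq_comm]
  · obtain ⟨a, ha, haI⟩ := (Set.powersetCard.exists_mem_notMem_iff_ne _ _).1 (Ne.symm h)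
    obtain ⟨r, rfl⟩ := (Set.powersetCard.mem_ofFinEmbEquiv_iff_mem_range _ _).1 ha
    apply det_eq_zero_of_row_eq_zero r
    intro s
    have : ofFinEmbEquiv.symm I s ≠ φ r := fun e =>
      haI ((Set.powersetCard.mem_range_ofFinEmbEquiv_symm_iff_mem I _).1 ⟨s, e⟩)
    simp [this]

/-- The Cauchy–Binet formula. -/
theorem det_mul_eq_sum_minors [Fintype ι] (A : Matrix (Fin k) ι R) (B : Matrix ι (Fin k) R) :
    (A * B).det = ∑ I : Set.powersetCard ι k, (A.submatrix id (ofFinEmbEquiv.symm I)).det *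
      (B.submatrix (ofFinEmbEquiv.symm I) id).det := by
  -- Both sides are alternating in the rows of `A`, so increasing tuples of basis vectors suffice;
  -- there a single minor form survives.
  have key : (detRowAlternating.compLinearMap B.vecMulLinear : (ι → R) [⋀^Fin k]→ₗ[R] R) =
      ∑ I : Set.powersetCard ι k, (B.submatrix (ofFinEmbEquiv.symm I) id).det • minorForm R I := by
    apply alternatingMap_ext_single
    intro φ
    simp only [AlternatingMap.compLinearMap_apply, alternatingMap_sum_apply,
      AlternatingMap.smul_apply, minorForm_single, smul_eq_mul, mul_ite, mul_one, mul_zero,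
      Finset.sum_ite_eq', Finset.mem_univ, if_true]
    rw [Equiv.symm_apply_apply]
    change Matrix.det _ = _
    congr 1
    ext a b
    simp
  have := DFunLike.congr_fun key A.row
  simp only [alternatingMap_sum_apply, AlternatingMap.smul_apply, minorForm_apply, smul_eq_mul]
    at this
  calc (A * B).det = _ := rfl
    _ = _ := this
    _ = _ := Finset.sum_congr rfl fun I _ => mul_comm _ _

end CauchyBinet

/-! ### Minors of `T` -/

section Interlacing

variable {R : Type*} [CommRing R] {α : Type*} [LinearOrder α]

/-- The entry `1 + sgn (a - b)`. -/
def sgnEntry (R : Type*) [CommRing R] (a b : α) : R := if a < b then 0 else if a = b then 1 else 2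

theorem sgnEntry_of_lt {a b : α} (h : a < b) : sgnEntry R a b = 0 := by simp [sgnEntry, h]

theorem sgnEntry_self (a : α) : sgnEntry R a a = 1 := by simp [sgnEntry]

theorem sgnEntry_of_gt {a b : α} (h : b < a) : sgnEntry R a b = 2 := by
  simp [sgnEntry, h.not_gt, h.ne']

/-- Interlacing of two tuples. -/
def Interlaced {k : ℕ} (i j : Fin k → α) : Prop :=
  (∀ m, i m ≤ j m) ∧ ∀ m m' : Fin k, (m : ℕ) + 1 = m' → j m ≤ i m'

theorem interlaced_succ {k : ℕ} (i j : Fin (k + 1) → α) :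
    Interlaced i j ↔ i 0 ≤ j 0 ∧ (∀ m : Fin k, (m : ℕ) = 0 → j 0 ≤ i m.succ) ∧
      Interlaced (Fin.tail i) (Fin.tail j) := by
  simp only [Interlaced, Fin.tail, Fin.forall_fin_succ, Fin.val_zero, Fin.val_succ]
  constructor
  · rintro ⟨⟨h1, h2⟩, ⟨-, h3⟩, h4⟩
    exact ⟨h1, fun m hm => h3 m (by omega), h2, fun m m' h => (h4 m).2 m' (by omega)⟩
  · rintro ⟨h1, h3, h2, h4⟩
    exact ⟨⟨h1, h2⟩, ⟨by simp, fun m hm => h3 m (by omega)⟩,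
      fun m => ⟨by simp, fun m' h => h4 m m' (by omega)⟩⟩

open Classical in
/-- The number of entries of `j` that are not entries of `i`. -/
noncomputable def newCount {k : ℕ} (i j : Fin k → α) : ℕ :=
  (Finset.univ.filter fun m => j m ∉ Set.range i).card

-- Every later entry of `j` exceeds `j 0 ≥ i 0`, so dropping `i 0` does not affect whether it lies
-- in the range of `i`.
open Classical in
theorem newCount_succ {k : ℕ} {i j : Fin (k + 1) → α} (hj : StrictMono j) (h : i 0 ≤ j 0) :
    newCount i j = (if j 0 ∈ Set.range i then 0 else 1) + newCount (Fin.tail i) (Fin.tail j) := by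
  have : ∀ m : Fin k, (j m.succ ∈ Set.range i ↔ Fin.tail j m ∈ Set.range (Fin.tail i)) := by
    intro m
    have := h.trans_lt (hj (Fin.succ_pos m))
    simp only [Set.mem_range, Fin.exists_fin_succ, Fin.tail, this.ne, false_or]
  simp only [newCount, Finset.card_filter, Fin.sum_univ_succ, this]
  congr 1
  split_ifs <;> simp_all

theorem det_succ_of_row_zero {k : ℕ} (M : Matrix (Fin (k + 1)) (Fin (k + 1)) R)
    (h : ∀ s : Fin k, M 0 s.succ = 0) :
    M.det = M 0 0 * (M.submatrix Fin.succ Fin.succ).det := by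
  rw [det_succ_row_zero, Fin.sum_univ_succ]
  simp [h]

open Classical in
/-- The minors of the matrix with entries `1 + sgn (i - j)`. -/
theorem det_sgnEntry {k : ℕ} {i j : Fin k → α} (hi : StrictMono i) (hj : StrictMono j) :
    (of fun r s => sgnEntry R (j r) (i s)).det =
      if Interlaced i j then 2 ^ newCount i j else 0 := by
  induction k with
  | zero => simp [Interlaced, newCount]
  | succ k ih =>
    have hti : StrictMono (Fin.tail i) := fun a b h => hi (Fin.succ_lt_succ_iff.2 h)
    have htj : StrictMono (Fin.tail j) := fun a b h => hj (Fin.succ_lt_succ_iff.2 h)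
    have ih' := ih hti htj
    set M : Matrix (Fin (k + 1)) (Fin (k + 1)) R := of fun r s => sgnEntry R (j r) (i s) with hM
    have hsub : M.submatrix Fin.succ Fin.succ =
      of fun r s => sgnEntry R (Fin.tail j r) (Fin.tail i s) := rfl
    rw [interlaced_succ]
    rcases lt_or_ge (j 0) (i 0) with h0 | h0
    · rw [if_neg (fun h => h0.not_ge h.1)]
      apply det_eq_zero_of_row_eq_zero 0
      intro s
      exact sgnEntry_of_lt (h0.trans_le (hi.monotone (Fin.zero_le _)))
    rw [newCount_succ hj h0, pow_add]
    -- If `j 0` lies below `i 1` (or `i 1` does not exist), the first row vanishes beyond its first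
    -- entry.
    by_cases hlt : ∀ m : Fin k, (m : ℕ) = 0 → j 0 < i m.succ
    · have hlt' : ∀ m : Fin k, j 0 < i m.succ := fun m =>
        (hlt ⟨0, m.pos⟩ rfl).trans_le
          (hi.monotone (Fin.succ_le_succ_iff.2 (Fin.mk_le_of_le_val (Nat.zero_le _))))
      rw [det_succ_of_row_zero M fun s => sgnEntry_of_lt (hlt' s), hsub, ih']
      have : M 0 0 = 2 ^ (if j 0 ∈ Set.range i then 0 else 1) := by
        change sgnEntry R (j 0) (i 0) = _
        simp only [Set.mem_range, Fin.exists_fin_succ]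
        rcases h0.eq_or_lt with e | h
        · simp [e, sgnEntry_self]
        · rw [sgnEntry_of_gt h, if_neg, pow_one]
          simp only [h.ne, false_or, not_exists]
          exact fun x => (hlt' x).ne'
      rw [this]
      have hint : (∀ m : Fin k, (m : ℕ) = 0 → j 0 ≤ i m.succ) ↔ True :=
        iff_true_intro fun m hm => (hlt m hm).le
      simp only [h0, true_and, hint, mul_ite, mul_zero]
    · push Not at hlt
      obtain ⟨m, hm, hle⟩ := hlt
      obtain ⟨k, rfl⟩ : ∃ l, k = l + 1 := ⟨k - 1, by have := m.pos; omega⟩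
      obtain rfl : m = 0 := Fin.ext hm
      have hrows : ∀ r : Fin (k + 1), M r.succ 0 = 2 ∧ M r.succ 1 = 2 := fun r => by
        have h1 : i 1 < j r.succ := hle.trans_lt (hj (Fin.succ_pos r))
        exact ⟨sgnEntry_of_gt ((hi (by simp)).trans h1), sgnEntry_of_gt h1⟩
      have h00 : M 0 0 = 2 := sgnEntry_of_gt ((hi (by simp : (0 : Fin (k + 2)) < 1)).trans_le hle)
      rcases hle.eq_or_lt with e | hlt
      · have h01 : M 0 1 = 1 := by
          change sgnEntry R (j 0) (i 1) = 1
          rw [← e]; exact sgnEntry_self _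
        -- Here `j 0 = i 1`: columns 0 and 1 agree except for the entries 2 and 1 in row 0, so
        -- subtracting column 1 turns column 0 into the first basis vector.
        have hcol := det_updateCol_add_smul_self M (by simp : (0 : Fin (k + 2)) ≠ 1) (-1)
        rw [← hcol, det_succ_column_zero, Fin.sum_univ_succ]
        have hmem : j 0 ∈ Set.range i := ⟨1, e⟩
        have hint : (∀ m : Fin (k + 1), (m : ℕ) = 0 → j 0 ≤ i m.succ) ↔ True := by
          refine iff_true_intro ?_
          intro m hm
          obtain rfl : m = 0 := Fin.ext hm
          exact e.ge
        have hs : (M.updateCol 0 fun l => M l 0 + -1 • M l 1).submatrix Fin.succ Fin.succ =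
            M.submatrix Fin.succ Fin.succ := by
          ext a b
          simp
        have h2 : (2 : R) + -1 = 1 := by ring
        simp only [hmem, hint, h0, true_and, if_true, pow_zero, one_mul]
        rw [← ih', ← hsub, ← hs]
        simp [h00, h01, hrows, h2]
      -- Here `j 0 > i 1`: columns 0 and 1 both consist of 2s.
      · rw [if_neg fun h => hlt.not_ge (h.2.1 0 rfl)]
        refine det_zero_of_column_eq (by simp : (0 : Fin (k + 2)) ≠ 1) fun r => ?_
        induction r using Fin.cases with
        | zero => rw [h00]; exact (sgnEntry_of_gt hlt).symm
        | succ r => rw [(hrows r).1, (hrows r).2]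

end Interlacing
-- The Gram determinant of the form `xᵀ T y`
section Gram

variable {R : Type*} [CommRing R] {ι : Type*} [LinearOrder ι] {k : ℕ}

theorem exists_orderEmb_removeNth (φ : Fin k ↪o ι) {l : ι} (hl : l ∉ Set.range φ) :
    ∃ (ψ : Fin (k + 1) ↪o ι) (r : Fin (k + 1)), ψ r = l ∧ ∀ j, φ j = ψ (r.succAbove j) := by
  have hmem : l ∉ Finset.univ.image φ := by simpa using hl
  have hc : (insert l (Finset.univ.image φ)).card = k + 1 := by
    rw [Finset.card_insert_of_notMem hmem, Finset.card_image_of_injective _ φ.injective]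
    simp
  set ψ := (insert l (Finset.univ.image φ)).orderEmbOfFin hc with hψ
  have hrange : Set.range ψ = insert l (Set.range φ) := by
    rw [hψ, Finset.range_orderEmbOfFin]
    simp
  obtain ⟨r, hr⟩ : l ∈ Set.range ψ := hrange ▸ Set.mem_insert _ _
  refine ⟨ψ, r, hr, ?_⟩
  have h1 : Finset.card (Finset.univ.image φ) = k := by
    rw [Finset.card_image_of_injective _ φ.injective]; simp
  have h2 := Finset.orderEmbOfFin_unique h1 (f := φ) (by simp) φ.strictMono
  have h3 := Finset.orderEmbOfFin_unique h1 (f := ψ ∘ r.succAbove) (fun j => by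
    have : ψ (r.succAbove j) ∈ insert l (Set.range φ) := hrange ▸ Set.mem_range_self _
    rcases this with h | h
    · exact absurd (ψ.injective (h.trans hr.symm)) (Fin.succAbove_ne r j)
    · simpa using h) (ψ.strictMono.comp (Fin.strictMono_succAbove r))
  exact fun j => congrFun (h2.trans h3.symm) j

variable [Fintype ι]

/-- The sum of all maximal minors, as an alternating form in the rows. -/
def sumMinors (R : Type*) [CommRing R] (ι : Type*) [LinearOrder ι] [Fintype ι] (k : ℕ) :
    (ι → R) [⋀^Fin k]→ₗ[R] R :=
  ∑ I : Set.powersetCard ι k, minorForm R I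

theorem sumMinors_apply (v : Fin k → ι → R) :
    sumMinors R ι k v =
      ∑ I : Set.powersetCard ι k, ((of v).submatrix id (ofFinEmbEquiv.symm I)).det := by
  rw [sumMinors, alternatingMap_sum_apply]
  rfl

theorem sumMinors_single (φ : Fin k ↪o ι) :
    sumMinors R ι k (fun r => Pi.single (φ r) 1) = 1 := by
  simp [sumMinors, alternatingMap_sum_apply, minorForm_single]

theorem sumMinors_zero (v : Fin 0 → ι → R) : sumMinors R ι 0 v = 1 := by
  rw [← sumMinors_single (R := R) (ι := ι) (OrderEmbedding.ofStrictMono (Fin.elim0 ·)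
    (fun a => a.elim0))]
  congr 1
  exact Subsingleton.elim _ _

theorem sumMinors_map {A : Type*} [CommRing A] (g : R →+* A) (v : Fin k → ι → R) :
    sumMinors A ι k (fun j i => g (v j i)) = g (sumMinors R ι k v) := by
  simp only [sumMinors_apply, map_sum, RingHom.map_det]
  rfl

/-- The linear form given by the row `l` of the matrix with entries `1 + sgn (i - j)`. -/
def rowForm (R : Type*) [CommRing R] (l : ι) : (ι → R) →ₗ[R] R :=
  ∑ b, sgnEntry R l b • LinearMap.proj b

theorem rowForm_apply (l : ι) (x : ι → R) : rowForm R l x = ∑ b, sgnEntry R l b * x b := by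
  simp [rowForm]

theorem rowForm_single (l b : ι) : rowForm R l (Pi.single b 1) = sgnEntry R l b := by
  simp [rowForm_apply, Pi.single_apply]

/-- The bilinear form of the matrix with entries `1 + sgn (i - j)`. -/
def sgnForm (x y : ι → R) : R := ∑ l, x l * rowForm R l y

theorem sum_alternating_below (r m : ℕ) :
    ∑ j ∈ Finset.range m, (-1 : R) ^ j * (if j < r then 2 else 0) = 1 - (-1) ^ min m r := by
  induction m with
  | zero => simp
  | succ m ih =>
    rw [Finset.sum_range_succ, ih]
    split_ifs with h
    · rw [min_eq_left h.le, min_eq_left h, pow_succ]; ring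
    · rw [min_eq_right (by omega), min_eq_right (by omega)]; ring

theorem sum_alternating_at (r m : ℕ) :
    ∑ j ∈ Finset.range m, (-1 : R) ^ j * (if j < r then 2 else if j = r then 1 else 0) =
      if m ≤ r then 1 - (-1) ^ m else 1 := by
  induction m with
  | zero => simp
  | succ m ih =>
    rw [Finset.sum_range_succ, ih]
    rcases lt_trichotomy m r with h | h | h
    · rw [if_pos h.le, if_pos h, if_pos (by omega), pow_succ]; ring
    · rw [if_pos h.le, if_neg (by omega), if_pos h, if_neg (by omega)]; ring
    · rw [if_neg (by omega), if_neg (by omega), if_neg (by omega), if_neg (by omega)]; ring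

/-- The entries are 2 before the position `r` of `l` and 0 after it. If `l` is new, the alternating
sum is `1 - (-1) ^ r`, and `(-1) ^ r` is the sign of sorting `l` into `φ`. If `l = φ r`, the extra
term `(-1) ^ r` leaves 1, and the form vanishes on a repeated vector. -/
theorem sum_sgnEntry_single (l : ι) (φ : Fin k ↪o ι) :
    ∑ j : Fin k, (-1 : R) ^ (j : ℕ) * sgnEntry R l (φ j) =
      1 - sumMinors R ι (k + 1) (vecCons (Pi.single l 1) fun r => Pi.single (φ r) 1) := by
  by_cases hl : l ∈ Set.range φ
  · obtain ⟨r, rfl⟩ := hl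
    rw [AlternatingMap.map_eq_zero_of_eq _ _ (i := 0) (j := r.succ) (by simp)
      (Fin.succ_ne_zero r).symm, sub_zero]
    have : ∀ j : Fin k, sgnEntry R (φ r) (φ j) =
        if (j : ℕ) < r then 2 else if (j : ℕ) = r then 1 else 0 := by
      intro j
      rcases lt_trichotomy j r with h | h | h
      · rw [sgnEntry_of_gt (φ.strictMono h), if_pos (Fin.lt_def.1 h)]
      · rw [h, sgnEntry_self]; simp
      · rw [sgnEntry_of_lt (φ.strictMono h), if_neg (by omega), if_neg (by omega)]
    simp only [this]
    rw [Fin.sum_univ_eq_sum_range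
      (fun j => (-1 : R) ^ j * (if j < (r : ℕ) then 2 else if j = r then 1 else 0)),
      sum_alternating_at, if_neg (by omega)]
  · obtain ⟨ψ, r, rfl, hφ⟩ := exists_orderEmb_removeNth φ hl
    have h1 : sumMinors R ι (k + 1) (vecCons (Pi.single (ψ r) 1) fun r => Pi.single (φ r) 1) =
        (-1) ^ (r : ℕ) := by
      rw [← AlternatingMap.neg_one_pow_smul_map_insertNth _ r]
      have : r.insertNth (Pi.single (ψ r) 1) (fun r => Pi.single (φ r) 1) =
          fun a => (Pi.single (ψ a) 1 : ι → R) := by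
        rw [Fin.insertNth_eq_iff]
        exact ⟨rfl, funext fun j => by rw [hφ]; rfl⟩
      rw [this, sumMinors_single]
      simp
    have : ∀ j : Fin k, sgnEntry R (ψ r) (φ j) = if (j : ℕ) < r then 2 else 0 := by
      intro j
      rw [hφ]
      split_ifs with h
      · exact sgnEntry_of_gt (ψ.strictMono (Fin.succAbove_lt_iff_castSucc_lt _ _ |>.2 h))
      · refine sgnEntry_of_lt (ψ.strictMono (Fin.lt_succAbove_iff_le_castSucc _ _ |>.2 ?_))
        exact not_lt.1 h
    simp only [this]
    rw [Fin.sum_univ_eq_sum_range (fun j => (-1 : R) ^ j * (if j < (r : ℕ) then 2 else 0)),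
      sum_alternating_below, h1, min_eq_right (by omega)]

/-- Expansion of the sum of maximal minors along a row of the matrix with entries
`1 + sgn (i - j)`. -/
theorem sum_rowForm_mul_sumMinors (l : ι) (v : Fin (k + 1) → ι → R) :
    ∑ j : Fin (k + 1), (-1 : R) ^ (j : ℕ) * (rowForm R l (v j) * sumMinors R ι k (j.removeNth v)) =
      sumMinors R ι (k + 1) v - sumMinors R ι (k + 2) (vecCons (Pi.single l 1) v) := by
  -- Both sides are alternating in `v`, which reduces the identity to `sum_sgnEntry_single`.
  have key : AlternatingMap.alternatizeUncurryFin ((rowForm R l).smulRight (sumMinors R ι k)) =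
      sumMinors R ι (k + 1) - (sumMinors R ι (k + 2)).curryLeft (Pi.single l 1) := by
    apply alternatingMap_ext_single
    intro φ
    rw [AlternatingMap.alternatizeUncurryFin_apply, AlternatingMap.sub_apply,
      AlternatingMap.curryLeft_apply_apply, sumMinors_single, ← sum_sgnEntry_single]
    refine Finset.sum_congr rfl fun j _ => ?_
    have := sumMinors_single (R := R) ((Fin.succAboveOrderEmb j).trans φ)
    have h2 : j.removeNth (fun r => (Pi.single (φ r) 1 : ι → R)) =
      fun r => Pi.single (((Fin.succAboveOrderEmb j).trans φ) r) 1 := rfl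
    rw [LinearMap.smulRight_apply, AlternatingMap.smul_apply, h2, this, rowForm_single]
    simp
  have := DFunLike.congr_fun key v
  rw [AlternatingMap.alternatizeUncurryFin_apply, AlternatingMap.sub_apply,
      AlternatingMap.curryLeft_apply_apply] at this
  rw [← this]
  refine Finset.sum_congr rfl fun j _ => ?_
  rw [LinearMap.smulRight_apply, AlternatingMap.smul_apply]
  simp

theorem sumMinors_cons_eq_sum (y : ι → R) (v : Fin k → ι → R) :
    sumMinors R ι (k + 1) (vecCons y v) =
      ∑ l, y l * sumMinors R ι (k + 1) (vecCons (Pi.single l 1) v) := by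
  have h : y = ∑ l, y l • (Pi.single l 1 : ι → R) := by
    ext a; simp [Pi.single_apply]
  have := congrArg (fun z => (sumMinors R ι (k + 1)).curryLeft z v) h
  simp only [map_sum, map_smul, alternatingMap_sum_apply, AlternatingMap.smul_apply,
    AlternatingMap.curryLeft_apply_apply, smul_eq_mul] at this
  exact this

theorem sum_sgnForm_mul_sumMinors (y : ι → R) (v : Fin (k + 1) → ι → R) :
    ∑ j, sgnForm y (v j) * ((-1) ^ (j : ℕ) * sumMinors R ι k (j.removeNth v)) =
      (∑ l, y l) * sumMinors R ι (k + 1) v - sumMinors R ι (k + 2) (vecCons y v) := by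
  rw [sumMinors_cons_eq_sum y v, Finset.sum_mul, ← Finset.sum_sub_distrib]
  simp only [← mul_sub, ← sum_rowForm_mul_sumMinors, sgnForm, Finset.sum_mul, Finset.mul_sum]
  rw [Finset.sum_comm]
  exact Finset.sum_congr rfl fun l _ => Finset.sum_congr rfl fun j _ => by ring

/-- Hiding the coefficients allows `k = 0` as well: the left side is then empty and the right side
is `∑ y - ∑ y`. -/
theorem exists_sum_sgnForm_mul (v : Fin k → ι → R) : ∃ c : Fin k → R, ∀ y,
    ∑ j, sgnForm y (v j) * c j =
      (∑ l, y l) * sumMinors R ι k v - sumMinors R ι (k + 1) (vecCons y v) := by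
  cases k with
  | succ k => exact ⟨_, fun y => sum_sgnForm_mul_sumMinors y v⟩
  | zero =>
    refine ⟨0, fun y => ?_⟩
    have h1 : ∀ l : ι, sumMinors R ι 1 (vecCons (Pi.single l 1) v) = 1 := by
      intro l
      refine Eq.trans ?_ (sumMinors_single (R := R) (ι := ι) (OrderEmbedding.ofStrictMono
        (fun _ : Fin 1 => l) (Subsingleton.strictMono _)))
      congr 1
      ext a b
      simp [Subsingleton.elim a 0]
    rw [sumMinors_cons_eq_sum]
    simp [sumMinors_zero, h1]

/-- The Gram matrix of a tuple of vectors for `sgnForm`. -/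
def gram (v : Fin k → ι → R) : Matrix (Fin k) (Fin k) R := of fun a b => sgnForm (v a) (v b)

/-- The expansions for `(x, v)` and for `v` are combined with weights `f` and `-F`, which cancels
the terms in `∑ y`. Taking `y` among `x, v` kills the remaining forms with a repeated vector,
leaving a linear system with right side `F ^ 2` in row 0 only; Cramer's rule then reads off the
claim. -/
theorem det_gram_mul_sq (x : ι → R) (v : Fin k → ι → R) :
    (gram (vecCons x v)).det * sumMinors R ι k v ^ 2 =
      (gram v).det * sumMinors R ι (k + 1) (vecCons x v) ^ 2 := by
  obtain ⟨c', hc'⟩ := exists_sum_sgnForm_mul v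
  have hc := fun y => sum_sgnForm_mul_sumMinors y (vecCons x v)
  set f := sumMinors R ι k v with hf
  set F := sumMinors R ι (k + 1) (vecCons x v) with hF
  set d : Fin (k + 1) → R := fun j =>
    f * ((-1) ^ (j : ℕ) * sumMinors R ι k (j.removeNth (vecCons x v))) - F * vecCons 0 c' j with hd
  have hd0 : d 0 = f ^ 2 := by
    change f * ((-1) ^ 0 * f) - F * 0 = f ^ 2
    ring
  have hG : gram (vecCons x v) *ᵥ d = Pi.single 0 (F ^ 2) := by
    ext a
    have h1 := hc (vecCons x v a)
    have h2 := hc' (vecCons x v a)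
    have h3 : sumMinors R ι (k + 2) (vecCons (vecCons x v a) (vecCons x v)) = 0 :=
      AlternatingMap.map_eq_zero_of_eq _ _ (i := 0) (j := a.succ) (by simp)
        (Fin.succ_ne_zero a).symm
    have h4 : F * sumMinors R ι (k + 1) (vecCons (vecCons x v a) v) =
        (Pi.single 0 (F ^ 2) : Fin (k + 1) → R) a := by
      induction a using Fin.cases with
      | zero => simp [← hF, sq]
      | succ a =>
        rw [AlternatingMap.map_eq_zero_of_eq _ _ (i := 0) (j := a.succ) (by simp)
          (Fin.succ_ne_zero a).symm]
        simp
    have h5 : ∑ j, sgnForm (vecCons x v a) (vecCons x v j) * vecCons 0 c' j =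
        ∑ j, sgnForm (vecCons x v a) (v j) * c' j := by
      rw [Fin.sum_univ_succ]
      simp
    calc (gram (vecCons x v) *ᵥ d) a
        = f * ∑ j, sgnForm (vecCons x v a) (vecCons x v j) *
              ((-1) ^ (j : ℕ) * sumMinors R ι k (j.removeNth (vecCons x v))) -
            F * ∑ j, sgnForm (vecCons x v a) (vecCons x v j) * vecCons 0 c' j := by
          simp only [Finset.mul_sum, ← Finset.sum_sub_distrib]
          change ∑ j, sgnForm (vecCons x v a) (vecCons x v j) * d j = _
          exact Finset.sum_congr rfl fun j _ => by simp only [hd]; ring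
      _ = (Pi.single 0 (F ^ 2) : Fin (k + 1) → R) a := by
          rw [h5, h1, h2, h3, ← h4]; ring
  have h := congrFun (congrArg ((gram (vecCons x v)).adjugate *ᵥ ·) hG) 0
  simp only [mulVec_mulVec, adjugate_mul, smul_mulVec, one_mulVec, Pi.smul_apply, smul_eq_mul,
    hd0, mulVec_single, MulOpposite.smul_eq_mul_unop, MulOpposite.unop_op, col_apply] at h
  rw [h, adjugate_fin_succ_eq_det_submatrix]
  simp only [Fin.val_zero, add_zero, pow_zero, one_mul]
  rfl

theorem gram_map {A : Type*} [CommRing A] (g : R →+* A) (v : Fin k → ι → R) :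
    gram (fun j i => g (v j i)) = (gram v).map g := by
  ext a b
  have : ∀ l m : ι, g (sgnEntry R l m) = sgnEntry A l m := by
    intro l m
    unfold sgnEntry
    split_ifs
    exacts [map_zero g, map_one g, map_ofNat g 2]
  simp [gram, sgnForm, rowForm_apply, this]

theorem det_gram_of_generic (h : (gram (R := MvPolynomial (Fin k × ι) ℤ)
      fun j i => MvPolynomial.X (j, i)).det =
        sumMinors (MvPolynomial (Fin k × ι) ℤ) ι k (fun j i => MvPolynomial.X (j, i)) ^ 2)
    (v : Fin k → ι → R) : (gram v).det = sumMinors R ι k v ^ 2 := by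
  set g := MvPolynomial.eval₂Hom (Int.castRingHom R) (fun p : Fin k × ι => v p.1 p.2) with hg
  have hv : (fun j i => g (MvPolynomial.X (j, i))) = v := by
    ext j i
    simp [hg]
  rw [← hv, gram_map, sumMinors_map, ← map_pow, ← h, RingHom.map_det]
  rfl

/-- Specializing the vectors to distinct basis vectors in increasing order gives the value 1; this
needs `k` basis vectors. -/
theorem sumMinors_tail_generic_ne_zero (hk : k ≤ Fintype.card ι) :
    sumMinors (MvPolynomial (Fin (k + 1) × ι) ℤ) ι k
      (fun j i => MvPolynomial.X (j.succ, i)) ≠ 0 := by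
  intro h
  obtain ⟨s, -, hs⟩ := Finset.exists_subset_card_eq (s := (Finset.univ : Finset ι)) hk
  set φ : Fin k ↪o ι := s.orderEmbOfFin hs
  set g := MvPolynomial.eval₂Hom (RingHom.id ℤ) (fun p : Fin (k + 1) × ι =>
    (Fin.cases 0 (fun j => Pi.single (φ j) 1) p.1 : ι → ℤ) p.2) with hg
  have h1 := sumMinors_map g (fun (j : Fin k) (i : ι) =>
    (MvPolynomial.X (j.succ, i) : MvPolynomial (Fin (k + 1) × ι) ℤ))
  rw [h, map_zero] at h1
  have h2 : (fun (j : Fin k) (i : ι) => g (MvPolynomial.X (j.succ, i))) =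
      fun j => (Pi.single (φ j) 1 : ι → ℤ) := by
    ext j i
    simp [hg]
  rw [h2, sumMinors_single] at h1
  exact one_ne_zero h1

theorem det_gram_generic (hk : k ≤ Fintype.card ι) :
    (gram (R := MvPolynomial (Fin k × ι) ℤ) fun j i => MvPolynomial.X (j, i)).det =
      sumMinors (MvPolynomial (Fin k × ι) ℤ) ι k (fun j i => MvPolynomial.X (j, i)) ^ 2 := by
  induction k with
  | zero => rw [det_isEmpty, sumMinors_zero, one_pow]
  | succ k ih =>
    have hk' : k ≤ Fintype.card ι := (Nat.le_succ k).trans hk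
    have hne := sumMinors_tail_generic_ne_zero hk'
    set v : Fin k → ι → MvPolynomial (Fin (k + 1) × ι) ℤ :=
      fun j i => MvPolynomial.X (j.succ, i) with hv
    have hcons : (fun (j : Fin (k + 1)) (i : ι) =>
        (MvPolynomial.X (j, i) : MvPolynomial (Fin (k + 1) × ι) ℤ)) =
        vecCons (fun i => MvPolynomial.X (0, i)) v := by
      ext1 j
      induction j using Fin.cases <;> rfl
    have := det_gram_mul_sq (fun i => MvPolynomial.X (0, i)) v
    rw [det_gram_of_generic (ih hk') v, mul_comm] at this
    rw [hcons]
    -- Cancelling the square is legitimate in the integral domain of integer polynomials; arbitrary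
    -- rings follow by specialization.
    exact mul_left_cancel₀ (pow_ne_zero 2 hne) this

/-- The Gram determinant for `sgnForm` is the square of the sum of the maximal minors. -/
theorem det_gram (hk : k ≤ Fintype.card ι) (v : Fin k → ι → R) :
    (gram v).det = sumMinors R ι k v ^ 2 :=
  det_gram_of_generic (det_gram_generic hk) v

end Gram
-- Part (a) and decomposition of symmetric matrices
variable {R : Type*} [CommRing R] {n k : ℕ}

theorem newCount_enum (I J : Set.powersetCard (Fin n) k) : newCount (enum I) (enum J) = p I J := by
  have h1 : Set.range (enum I) = (I : Finset (Fin n)) := Finset.range_orderEmbOfFin _ _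
  have h2 : (Finset.univ.filter fun m => enum J m ∉ Set.range (enum I)).image (enum J) =
      (J : Finset (Fin n)) \ (I : Finset (Fin n)) := by
    have h3 : Set.range (enum J) = (J : Finset (Fin n)) := Finset.range_orderEmbOfFin _ _
    ext a
    have h4 : a ∈ (J : Finset (Fin n)) ↔ ∃ m, enum J m = a := by
      rw [← Finset.mem_coe, ← h3, Set.mem_range]
    simp only [h1, Finset.mem_image, Finset.mem_filter, Finset.mem_univ, true_and,
      Finset.mem_sdiff, h4, Finset.mem_coe]
    constructor
    · rintro ⟨m, hm, rfl⟩
      exact ⟨⟨m, rfl⟩, hm⟩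
    · rintro ⟨⟨m, rfl⟩, hm⟩
      exact ⟨m, hm, rfl⟩
  have h5 := congrArg Finset.card h2
  rw [Finset.card_image_of_injective _ (enum J).injective, Finset.card_sdiff] at h5
  rw [Set.powersetCard.card_eq J] at h5
  unfold newCount p
  convert h5

theorem minor_T (I J : Set.powersetCard (Fin n) k) :
    minor (T n R) J I = if Interlacing I J then 2 ^ p I J else 0 := by
  classical
  have h := det_sgnEntry (R := R) (enum I).strictMono (enum J).strictMono
  rw [newCount_enum] at h
  exact h.trans (if_congr Iff.rfl rfl rfl)

theorem minor_mul (A B : Matrix (Fin n) (Fin n) R) (I J : Set.powersetCard (Fin n) k) :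
    minor (A * B) I J = ∑ K : Set.powersetCard (Fin n) k, minor A I K * minor B K J :=
  det_mul_eq_sum_minors (A.submatrix (enum I) id) (B.submatrix id (enum J))

theorem sum_principal_minors_T_mul (X : Matrix (Fin n) (Fin n) R) :
    ∑ I : Set.powersetCard (Fin n) k, minor (T n R * X) I I = S k X := by
  simp only [minor_mul, minor_T, ite_mul, zero_mul]
  rw [Finset.sum_comm, S, Finset.sum_filter, Fintype.sum_prod_type]

/-- A symmetric matrix is a linear combination of matrices `v vᵀ`. -/
theorem exists_eq_mul_diagonal_mul_transpose {X : Matrix (Fin n) (Fin n) R} (hX : X.IsSymm) :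
    ∃ (m : ℕ) (V : Matrix (Fin n) (Fin m) R) (c : Fin m → R), X = V * diagonal c * Vᵀ := by
  -- For `a < b`, `X a b` is the weight of `(e_a + e_b)(e_a + e_b)ᵀ`; `D a` corrects the diagonal
  -- with `e_a e_aᵀ`. No division by 2 is needed.
  set w : Fin n → Fin n → R := fun a b => if a < b then X a b else 0 with hw
  set D : Fin n → R := fun a => X a a - ∑ b, w a b - ∑ b, w b a with hD
  set W : Fin n → (Fin n ⊕ Fin n × Fin n) → R :=
    fun i => Sum.elim (fun a => if i = a then 1 else 0)
      (fun q => (if i = q.1 then 1 else 0) + (if i = q.2 then 1 else 0)) with hW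
  set e := Fintype.equivFin (Fin n ⊕ Fin n × Fin n)
  refine ⟨_, of fun i l => W i (e.symm l), fun l => Sum.elim D (fun q => w q.1 q.2) (e.symm l), ?_⟩
  ext i j
  have key : X i j = ∑ s, W i s * Sum.elim D (fun q => w q.1 q.2) s * W j s := by
    rw [Fintype.sum_sum_type, Fintype.sum_prod_type]
    simp only [hW, Sum.elim_inl, Sum.elim_inr, add_mul, mul_add, ite_mul, mul_ite, one_mul, mul_one,
      zero_mul, mul_zero, Finset.sum_add_distrib, Finset.sum_ite_eq, Finset.mem_univ, if_true,
      Finset.sum_ite_irrel, Finset.sum_const_zero]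
    rcases lt_trichotomy i j with h | h | h
    · simp [h.ne, hw, h, h.not_gt]
    · subst h
      simp [hD, hw]
    · simp [h.ne', hw, h, h.not_gt, hX.apply i j]
  rw [key, mul_apply, ← e.symm.sum_comp]
  simp [mul_diagonal]

/-! ### Both sides of (b) for `X = V * diagonal c * Vᵀ` -/

section Decomposition

variable {m : ℕ} (V : Matrix (Fin n) (Fin m) R) (c : Fin m → R)

theorem det_mul_diagonal_submatrix (A : Matrix (Fin k) (Fin m) R) (f : Fin k → Fin m) :
    ((A * diagonal c).submatrix id f).det = (∏ r, c (f r)) * (A.submatrix id f).det := by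
  have : (A * diagonal c).submatrix id f = A.submatrix id f * diagonal (c ∘ f) := by
    ext a b
    simp [mul_diagonal]
  rw [this, det_mul, det_diagonal, mul_comm]
  rfl

theorem sum_minors_mul_diagonal_mul_transpose :
    ∑ I : Set.powersetCard (Fin n) k, ∑ J : Set.powersetCard (Fin n) k,
        minor (V * diagonal c * Vᵀ) I J =
      ∑ L : Set.powersetCard (Fin m) k, (∏ r, c (ofFinEmbEquiv.symm L r)) *
        sumMinors R (Fin n) k (fun r => Vᵀ (ofFinEmbEquiv.symm L r)) ^ 2 := by
  have h : ∀ I J : Set.powersetCard (Fin n) k, minor (V * diagonal c * Vᵀ) I J =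
      ∑ L : Set.powersetCard (Fin m) k, (∏ r, c (ofFinEmbEquiv.symm L r)) *
        (((of fun r => Vᵀ (ofFinEmbEquiv.symm L r)).submatrix id (ofFinEmbEquiv.symm I)).det *
          ((of fun r => Vᵀ (ofFinEmbEquiv.symm L r)).submatrix id (ofFinEmbEquiv.symm J)).det) := by
    intro I J
    refine (det_mul_eq_sum_minors ((V.submatrix (enum I) id) * diagonal c)
      (Vᵀ.submatrix id (enum J))).trans (Finset.sum_congr rfl fun L _ => ?_)
    rw [det_mul_diagonal_submatrix, mul_assoc, ← det_transpose]
    rfl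
  simp only [h, sumMinors_apply, sq]
  rw [Finset.sum_congr rfl fun I _ => Finset.sum_comm, Finset.sum_comm]
  simp only [← Finset.mul_sum, ← Finset.sum_mul]

theorem sum_principal_minors_T_mul_diagonal :
    ∑ I : Set.powersetCard (Fin n) k, minor (T n R * (V * diagonal c * Vᵀ)) I I =
      ∑ L : Set.powersetCard (Fin m) k, (∏ r, c (ofFinEmbEquiv.symm L r)) *
        (gram (fun r => Vᵀ (ofFinEmbEquiv.symm L r))).det := by
  have h : ∀ I : Set.powersetCard (Fin n) k, minor (T n R * (V * diagonal c * Vᵀ)) I I =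
      ∑ L : Set.powersetCard (Fin m) k, (∏ r, c (ofFinEmbEquiv.symm L r)) *
        (((Vᵀ.submatrix (ofFinEmbEquiv.symm L) id).submatrix id (ofFinEmbEquiv.symm I)).det *
          (((T n R * V).submatrix id (ofFinEmbEquiv.symm L)).submatrix
            (ofFinEmbEquiv.symm I) id).det) := by
    intro I
    rw [← Matrix.mul_assoc, ← Matrix.mul_assoc]
    refine (det_mul_eq_sum_minors (((T n R * V).submatrix (enum I) id) * diagonal c)
      (Vᵀ.submatrix id (enum I))).trans (Finset.sum_congr rfl fun L _ => ?_)
    rw [det_mul_diagonal_submatrix, mul_assoc, mul_comm (det _) (det _)]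
    rfl
  simp only [h]
  rw [Finset.sum_comm]
  refine Finset.sum_congr rfl fun L _ => ?_
  -- Cauchy–Binet read backwards assembles the sum over `I` into the Gram determinant.
  rw [← Finset.mul_sum, ← det_mul_eq_sum_minors]
  congr 2
  ext a b
  simp only [gram, sgnForm, rowForm_apply, mul_apply, submatrix_apply, of_apply]
  rfl

end Decomposition

end CanadaDay

theorem theorem2 {R : Type*} [CommRing R] (n k : ℕ) (hk : 1 ≤ k) (hkn : k ≤ n)
    (X : Matrix (Fin n) (Fin n) R) :
    (∑ I : Set.powersetCard (Fin n) k, CanadaDay.minor (CanadaDay.T n R * X) I I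
        = CanadaDay.S k X) ∧
    (X.IsSymm →
      ∑ I : Set.powersetCard (Fin n) k, ∑ J : Set.powersetCard (Fin n) k, CanadaDay.minor X I J
        = CanadaDay.S k X) := by
  refine ⟨CanadaDay.sum_principal_minors_T_mul X, fun hX => ?_⟩
  rw [← CanadaDay.sum_principal_minors_T_mul X]
  obtain ⟨m, V, c, rfl⟩ := CanadaDay.exists_eq_mul_diagonal_mul_transpose hX
  rw [CanadaDay.sum_minors_mul_diagonal_mul_transpose,
    CanadaDay.sum_principal_minors_T_mul_diagonal]
  simp only [CanadaDay.det_gram (k := k) (ι := Fin n) (by simpa using hkn)]
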